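/- Let $p$ be a prime. Let $G$ be the Vilenkin group, i.e. the group of all sequences $x=(x_j)_{j\in\mathbb Z}$ with $x_j\in\{0,1,\dots,p-1\}$ and $x_j=0$ for all $j<k$ for some $k=k(x)\in\mathbb Z$, with coordinatewise addition modulo $p$, with the group topology in which the subgroups $U_l=\{x\in G: x_j=0\text{ for }j\le l\}$, $l\in\mathbb Z$, form a basis of neighbourhoods of $0$, and with the Haar measure $\mu$ normalized by $\mu(U_0)=1$. Let $H=\{x\in G: x_j=0\text{ for }j>0\}$, let $A$ be the automorphism of $G$ given by $(Ax)_j=x_{j+1}$, and for $h\in H$ let $T_hf(x)=f(x-h)$ for $f\in L^2(G)=L^2(G,\mu;\mathbb C)$. A sequence $\{V_j\}_{j\in\mathbb Z}$ of closed subspaces of $L^2(G)$ is called a Parseval frame multiresolution analysis (Parseval FMRA) if (i) $V_j\subseteq V_{j+1}$ for each $j\in\mathbb Z$; (ii) for each $j\in\mathbb Z$ and $f\in L^2(G)$, $f\in V_j$ if and only if $f(A\,\cdot)\in V_{j+1}$; (iii) $\overline{\bigcup_{j\in\mathbb Z}V_j}=L^2(G)$; (iv) $\bigcap_{j\in\mathbb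 Z}V_j=\{0\}$; (v) there exists $\phi\in V_0$ such that $\{T_h\phi:h\in H\}$ is a Parseval frame for $V_0$, that is, $T_h\phi\in V_0$ for all $h\in H$ and $\sum_{h\in H}|\langle f,T_h\phi\rangle|^2=\|f\|^2$ for all $f\in V_0$. It is called a multiresolution analysis (MRA) if (i)--(iv) hold and there exists $\varphi\in V_0$ such that $\{T_h\varphi:h\in H\}$ is an orthonormal basis of $V_0$. Theorem. For every Parseval FMRA $\{V_j\}_{j\in\mathbb Z}$ of $L^2(G)$ there exists an MRA $\{\mathcal V_j\}_{j\in\mathbb Z}$ of $L^2(G)$ such that $V_j\subseteq\mathcal V_j$ for each $j\in\mathbb Z$. -/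

import Mathlib

open MeasureTheory Topology Set
open scoped ENNReal NNReal

/-- The sequences `(x_j)_{j ∈ ℤ}` of digits modulo `p` that vanish for all sufficiently negative
indices, as a subgroup of all sequences under coordinatewise addition modulo `p`. -/
def vilenkinSubgroup (p : ℕ) : AddSubgroup (ℤ → ZMod p) where
  carrier := {x | ∃ k : ℤ, ∀ j : ℤ, j < k → x j = 0}
  zero_mem' := ⟨0, fun _ _ => rfl⟩
  add_mem' := by
    rintro x y ⟨k, hk⟩ ⟨l, hl⟩
    refine ⟨min k l, fun j hj => ?_⟩
    rw [Pi.add_apply, hk j (lt_of_lt_of_le hj (min_le_left _ _)),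
      hl j (lt_of_lt_of_le hj (min_le_right _ _)), add_zero]
  neg_mem' := by
    rintro x ⟨k, hk⟩
    exact ⟨k, fun j hj => by rw [Pi.neg_apply, hk j hj, neg_zero]⟩

/-- The Vilenkin group. It is a separate type, so that it does not inherit the
product topology of `ℤ → ZMod p`. -/
def VilenkinGroup (p : ℕ) : Type := vilenkinSubgroup p

namespace VilenkinGroup

variable {p : ℕ}

instance instAddCommGroup : AddCommGroup (VilenkinGroup p) :=
  inferInstanceAs (AddCommGroup (vilenkinSubgroup p))

/-- The `j`-th digit of `x`. -/
def digit (x : VilenkinGroup p) (j : ℤ) : ZMod p := x.1 j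

theorem digit_ext {x y : VilenkinGroup p} (h : ∀ j, x.digit j = y.digit j) : x = y :=
  Subtype.ext (funext h)

theorem digit_add (x y : VilenkinGroup p) (j : ℤ) :
    (x + y).digit j = x.digit j + y.digit j := rfl

theorem digit_neg (x : VilenkinGroup p) (j : ℤ) : (-x).digit j = -x.digit j := rfl

theorem digit_zero (j : ℤ) : (0 : VilenkinGroup p).digit j = 0 := rfl

/-- The subgroup `U_l = {x : x_j = 0 for j ≤ l}`. -/
def U (p : ℕ) (l : ℤ) : AddSubgroup (VilenkinGroup p) where
  carrier := {x | ∀ j : ℤ, j ≤ l → x.digit j = 0}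
  zero_mem' := fun _ _ => rfl
  add_mem' := fun {x y} hx hy j hj => by rw [digit_add, hx j hj, hy j hj, add_zero]
  neg_mem' := fun {x} hx j hj => by rw [digit_neg, hx j hj, neg_zero]

theorem mem_U {l : ℤ} {x : VilenkinGroup p} : x ∈ U p l ↔ ∀ j : ℤ, j ≤ l → x.digit j = 0 :=
  Iff.rfl

/-- The subgroups `U_l`, `l ∈ ℤ`, as a system of neighbourhoods of zero. -/
abbrev filterBasis (p : ℕ) : AddGroupFilterBasis (VilenkinGroup p) :=
  addGroupFilterBasisOfComm (range fun l : ℤ => (U p l : Set (VilenkinGroup p)))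
    (range_nonempty _)
    (by
      rintro _ _ ⟨k, rfl⟩ ⟨l, rfl⟩
      exact ⟨_, ⟨max k l, rfl⟩, fun x hx =>
        ⟨fun j hj => hx j (hj.trans (le_max_left _ _)),
          fun j hj => hx j (hj.trans (le_max_right _ _))⟩⟩)
    (by rintro _ ⟨l, rfl⟩; exact (U p l).zero_mem)
    (by
      rintro _ ⟨l, rfl⟩
      refine ⟨_, ⟨l, rfl⟩, ?_⟩
      rintro _ ⟨x, hx, y, hy, rfl⟩
      exact (U p l).add_mem hx hy)
    (by rintro _ ⟨l, rfl⟩; exact ⟨_, ⟨l, rfl⟩, fun x hx => (U p l).neg_mem hx⟩)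

/-- The topology in which the cosets `x + U_l`, `l ∈ ℤ`, form a basis of neighbourhoods of `x`. -/
instance instTopologicalSpace : TopologicalSpace (VilenkinGroup p) := (filterBasis p).topology

instance instIsTopologicalAddGroup : IsTopologicalAddGroup (VilenkinGroup p) :=
  (filterBasis p).isTopologicalAddGroup

theorem nhds_zero_hasBasis :
    (𝓝 (0 : VilenkinGroup p)).HasBasis (fun _ : ℤ => True)
      (fun l => (U p l : Set (VilenkinGroup p))) := by
  refine ((filterBasis p).nhds_zero_hasBasis).to_hasBasis ?_ ?_
  · rintro _ ⟨l, rfl⟩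
    exact ⟨l, trivial, subset_rfl⟩
  · intro l _
    exact ⟨_, ⟨l, rfl⟩, subset_rfl⟩

theorem isOpen_U (l : ℤ) : IsOpen (U p l : Set (VilenkinGroup p)) :=
  (U p l).isOpen_of_mem_nhds (nhds_zero_hasBasis.mem_of_mem trivial)

/-- Truncation to the digits of positive index; its image is `U_0`. -/
def truncate (y : ℤ → ZMod p) : VilenkinGroup p :=
  ⟨fun j => if 0 < j then y j else 0, 0, fun j hj => if_neg (by omega)⟩

theorem continuous_truncate : Continuous (truncate : (ℤ → ZMod p) → VilenkinGroup p) := by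
  rw [continuous_iff_continuousAt]
  intro y
  rw [ContinuousAt, ← tendsto_sub_nhds_zero_iff]
  rw [nhds_zero_hasBasis.tendsto_right_iff]
  intro l _
  have h : ∀ᶠ z in 𝓝 y, ∀ j ∈ Finset.Icc 1 l, z j = y j := by
    rw [Filter.eventually_all_finset]
    intro j _
    exact (continuous_apply j).continuousAt.eventually
      ((isOpen_discrete {y j}).mem_nhds (mem_singleton _))
  filter_upwards [h] with z hz j hj
  change (if 0 < j then z j else 0) - (if 0 < j then y j else 0) = 0
  split_ifs with h0
  · rw [hz j (Finset.mem_Icc.2 ⟨h0, hj⟩), sub_self]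
  · exact sub_zero 0

theorem range_truncate : range (truncate : (ℤ → ZMod p) → VilenkinGroup p) = U p 0 := by
  ext x
  constructor
  · rintro ⟨y, rfl⟩ j hj
    exact if_neg (by omega)
  · intro hx
    refine ⟨x.digit, digit_ext fun j => ?_⟩
    change (if 0 < j then x.digit j else 0) = x.digit j
    split_ifs with h
    · rfl
    · exact (hx j (by omega)).symm

theorem isCompact_U_zero [NeZero p] : IsCompact (U p 0 : Set (VilenkinGroup p)) := by
  rw [← range_truncate]
  exact isCompact_range continuous_truncate

/-- The compact open subgroup `U = U_0`, used to normalize Haar measure. -/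
def unitBall (p : ℕ) [NeZero p] : TopologicalSpace.PositiveCompacts (VilenkinGroup p) where
  carrier := U p 0
  isCompact' := isCompact_U_zero
  interior_nonempty' := by
    rw [(isOpen_U 0).interior_eq]
    exact ⟨0, (U p 0).zero_mem⟩

instance instLocallyCompactSpace [NeZero p] : LocallyCompactSpace (VilenkinGroup p) :=
  (unitBall p).locallyCompactSpace_of_addGroup

/-- The Borel `σ`-algebra. -/
instance instMeasurableSpace : MeasurableSpace (VilenkinGroup p) := borel _

instance instBorelSpace : BorelSpace (VilenkinGroup p) := ⟨rfl⟩

/-- Haar measure on the Vilenkin group, normalized by `μ(U) = 1`. -/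
noncomputable def haar (p : ℕ) [NeZero p] : Measure (VilenkinGroup p) :=
  Measure.addHaarMeasure (unitBall p)

instance instIsAddHaarMeasure_haar [NeZero p] : (haar p).IsAddHaarMeasure :=
  inferInstanceAs (Measure.addHaarMeasure (unitBall p)).IsAddHaarMeasure

instance instRegular_haar [NeZero p] : (haar p).Regular :=
  inferInstanceAs (Measure.addHaarMeasure (unitBall p)).Regular

theorem haar_U_zero [NeZero p] : haar p (U p 0) = 1 :=
  Measure.addHaarMeasure_self (K₀ := unitBall p)

/-- The discrete subgroup `H = {x : x_j = 0 for j > 0}` of translations. -/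
def H (p : ℕ) : AddSubgroup (VilenkinGroup p) where
  carrier := {x | ∀ j : ℤ, 0 < j → x.digit j = 0}
  zero_mem' := fun _ _ => rfl
  add_mem' := fun {x y} hx hy j hj => by rw [digit_add, hx j hj, hy j hj, add_zero]
  neg_mem' := fun {x} hx j hj => by rw [digit_neg, hx j hj, neg_zero]

/-- The shift of all digits by `n` places, `(x_j) ↦ (x_{j+n})`. -/
def shift (n : ℤ) (x : VilenkinGroup p) : VilenkinGroup p :=
  ⟨fun j => x.digit (j + n), by
    obtain ⟨k, hk⟩ := x.2
    exact ⟨k - n, fun j hj => hk (j + n) (by omega)⟩⟩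

theorem digit_shift (n : ℤ) (x : VilenkinGroup p) (j : ℤ) :
    (shift n x).digit j = x.digit (j + n) := rfl

theorem continuous_shift (n : ℤ) : Continuous (shift n : VilenkinGroup p → VilenkinGroup p) := by
  rw [continuous_iff_continuousAt]
  intro x
  rw [ContinuousAt, ← tendsto_sub_nhds_zero_iff, nhds_zero_hasBasis.tendsto_right_iff]
  intro l _
  have h : Filter.Tendsto (fun y : VilenkinGroup p => y - x) (𝓝 x) (𝓝 0) :=
    tendsto_sub_nhds_zero_iff.2 Filter.tendsto_id
  filter_upwards [nhds_zero_hasBasis.tendsto_right_iff.1 h (l + n) trivial] with y hy j hj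
  exact hy (j + n) (by omega)

/-- The automorphism `A` of the Vilenkin group, `(A x)_j = x_{j+1}`. -/
def A (p : ℕ) : VilenkinGroup p ≃ₜ+ VilenkinGroup p where
  toFun := shift 1
  invFun := shift (-1)
  left_inv x := digit_ext fun j => by rw [digit_shift, digit_shift]; congr 1; omega
  right_inv x := digit_ext fun j => by rw [digit_shift, digit_shift]; congr 1; omega
  map_add' _ _ := rfl
  continuous_toFun := continuous_shift 1
  continuous_invFun := continuous_shift (-1)

theorem digit_A (x : VilenkinGroup p) (j : ℤ) : (A p x).digit j = x.digit (j + 1) := rfl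

/-- The Hilbert space `L²` of the Vilenkin group, with complex values. -/
abbrev L2 (p : ℕ) [NeZero p] : Type := Lp ℂ 2 (haar p)

/-- Translation by `h`: `(T_h f)(x) = f(x - h)`. -/
noncomputable def translate [NeZero p] (h : VilenkinGroup p) (f : L2 p) : L2 p :=
  Lp.compMeasurePreserving (fun x => x - h) (measurePreserving_sub_right (haar p) h) f

theorem coeFn_translate [NeZero p] (h : VilenkinGroup p) (f : L2 p) :
    translate h f =ᵐ[haar p] fun x => f (x - h) :=
  Lp.coeFn_compMeasurePreserving f (measurePreserving_sub_right (haar p) h)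

theorem memLp_comp_A [NeZero p] (f : L2 p) : MemLp (fun x => f (A p x)) 2 (haar p) := by
  have hc : addEquivAddHaarChar (A p) ≠ 0 := (addEquivAddHaarChar_pos (A p)).ne'
  have h := addEquivAddHaarChar_smul_map (haar p) (A p)
  have hmap : (haar p).map (A p) = (addEquivAddHaarChar (A p))⁻¹ • haar p := by
    conv_rhs => rw [← h]
    rw [smul_smul, inv_mul_cancel₀ hc, one_smul]
  have hf : MemLp f 2 ((haar p).map (A p)) := by
    rw [hmap]
    exact (Lp.memLp f).smul_measure (c := ((addEquivAddHaarChar (A p))⁻¹ : ℝ≥0))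
      ENNReal.coe_ne_top
  exact hf.comp_of_map (A p).continuous.measurable.aemeasurable

/-- The element `f(A ·)` of `L²`, for `f` in `L²`. -/
noncomputable def compA [NeZero p] (f : L2 p) : L2 p := (memLp_comp_A f).toLp

theorem coeFn_compA [NeZero p] (f : L2 p) : compA f =ᵐ[haar p] fun x => f (A p x) :=
  (memLp_comp_A f).coeFn_toLp

/-- The family `e` of elements of the subspace `V` is a frame for `V` with bounds `a` and `b`. -/
structure IsFrameFor {ι E : Type*} [NormedAddCommGroup E] [InnerProductSpace ℂ E]
    (V : Submodule ℂ E) (e : ι → E) (a b : ℝ) : Prop where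
  pos : 0 < a
  le : a ≤ b
  mem : ∀ i, e i ∈ V
  summable : ∀ f ∈ V, Summable fun i => ‖inner ℂ f (e i)‖ ^ 2
  lower : ∀ f ∈ V, a * ‖f‖ ^ 2 ≤ ∑' i, ‖inner ℂ f (e i)‖ ^ 2
  upper : ∀ f ∈ V, ∑' i, ‖inner ℂ f (e i)‖ ^ 2 ≤ b * ‖f‖ ^ 2

/-- A Parseval frame is a frame with both bounds equal to `1`. -/
def IsParsevalFrameFor {ι E : Type*} [NormedAddCommGroup E] [InnerProductSpace ℂ E]
    (V : Submodule ℂ E) (e : ι → E) : Prop :=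
  IsFrameFor V e 1 1

/-- The family `e` is an orthonormal basis of the closed subspace `V`. -/
def IsOrthonormalBasisFor {ι E : Type*} [NormedAddCommGroup E] [InnerProductSpace ℂ E]
    (V : Submodule ℂ E) (e : ι → E) : Prop :=
  Orthonormal ℂ e ∧ (Submodule.span ℂ (range e)).topologicalClosure = V

/-- The conditions common to multiresolution analyses and frame multiresolution analyses. -/
structure IsDilationLadder [NeZero p] (V : ℤ → Submodule ℂ (L2 p)) : Prop where
  isClosed : ∀ j, IsClosed (V j : Set (L2 p))
  le_succ : ∀ j, V j ≤ V (j + 1)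
  mem_iff : ∀ j f, f ∈ V j ↔ compA f ∈ V (j + 1)
  closure_iUnion : closure (⋃ j, (V j : Set (L2 p))) = univ
  iInter_eq : ⋂ j, (V j : Set (L2 p)) = {0}

/-- A Parseval frame multiresolution analysis of `L²`: the translates by `H` of some `φ ∈ V_0`
form a Parseval frame for `V_0`. -/
structure IsParsevalFMRA [NeZero p] (V : ℤ → Submodule ℂ (L2 p)) : Prop
    extends IsDilationLadder V where
  exists_scaling : ∃ φ ∈ V 0, IsParsevalFrameFor (V 0) fun h : H p => translate (h : VilenkinGroup p) φ

/-- A multiresolution analysis of `L²`: the translates by `H` of some `φ ∈ V_0`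
form an orthonormal basis of `V_0`. -/
structure IsMRA [NeZero p] (V : ℤ → Submodule ℂ (L2 p)) : Prop
    extends IsDilationLadder V where
  exists_scaling :
    ∃ φ ∈ V 0, IsOrthonormalBasisFor (V 0) fun h : H p => translate (h : VilenkinGroup p) φ

end VilenkinGroup

/-! Write `D` for the unitary dilation, a multiple of `f ↦ f(A ·)`, and `T h` for the translations
by `H`. It suffices to find `ψ` with orthonormal translates whose closed span `W` contains `V 0` and
satisfies `D⁻¹ W ⊆ W`; the ladder of dilates `D^j W` is then the required MRA.

The indicator function `χ` of `U_0` has orthonormal translates, and their closed span `X` satisfies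
`D⁻¹ X ⊆ X`. The Parseval frame yields an equivariant partial isometry `J : X → L²` onto `V 0` with
`J (T h χ) = T h φ`. Let `e = J* J`. An equivariant isometry `L : X → L²` with `L = J + D L D⁻¹ (1 -
e)` agrees with `J` on the range of `e`, so `W = L X` contains `V 0`; moreover `D⁻¹ L w` lies in
`D⁻¹ (V 0) + L X ⊆ W`. So `ψ = L χ` works.

The equation is solved by iteration from the inclusion of `X` (`exists_equivariant_isometry`). Since
`H` is abelian, the operators on `X` commuting with translations form a commutative algebra. Hence
equivariant maps that live on the complementary projections `e` and `1 - e` have orthogonal ranges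
(`inner_eq_zero_of_equivariant`). This makes every iterate an isometry and the successive
differences pairwise orthogonal, so the iterates converge pointwise.

Density of the union is inherited from `V`. Triviality of the intersection holds for any orthonormal
translates (`eq_zero_of_forall_dilation_mem`): dilation concentrates a function near `0`, where it
only meets the part of `|ψ|²` near the null set `H`. -/

/-! ### Operators commuting with an abelian group of translations. -/

section EquivariantOperators

open ContinuousLinearMap

variable {H E K : Type*}
  [NormedAddCommGroup E] [InnerProductSpace ℂ E] [CompleteSpace E]
  [NormedAddCommGroup K] [InnerProductSpace ℂ K] [CompleteSpace K]
  {T : H → E →ₗᵢ[ℂ] E} {τ : H → K →ₗᵢ[ℂ] K}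

/-- Operators that commute with the translations of an orthonormal basis indexed by an abelian
group commute with each other. -/
theorem HilbertBasis.comm_of_comm_translate [AddCommGroup H] (b : HilbertBasis H ℂ K)
    (hτ : ∀ h k, τ h (b k) = b (h + k)) {X Y : K →L[ℂ] K}
    (hX : ∀ h v, X (τ h v) = τ h (X v)) (hY : ∀ h v, Y (τ h v) = τ h (Y v)) (v : K) :
    X (Y v) = Y (X v) := by
  -- The matrix of an equivariant operator is Toeplitz: its `(h, k)` entry depends only on `h - k`.
  have coeff : ∀ Z : K →L[ℂ] K, (∀ h v, Z (τ h v) = τ h (Z v)) → ∀ h k l : H,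
      inner ℂ (b (h + l)) (Z (b (k + l))) = inner ℂ (b h) (Z (b k)) := by
    intro Z hZ h k l
    rw [add_comm h, add_comm k, ← hτ, ← hτ, hZ, LinearIsometry.inner_map_map]
  have expand : ∀ (Z W : K →L[ℂ] K) (h k : H),
      HasSum (fun l => inner ℂ (b h) (Z (b l)) * inner ℂ (b l) (W (b k)))
        (inner ℂ (b h) (Z (W (b k)))) := by
    intro Z W h k
    have := b.hasSum_inner_mul_inner (adjoint Z (b h)) (W (b k))
    simpa only [adjoint_inner_left] using this
  suffices X ∘L Y = Y ∘L X from DFunLike.congr_fun this v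
  refine ContinuousLinearMap.ext_on (s := range b) ?_ ?_
  · rw [Submodule.dense_iff_topologicalClosure_eq_top]
    exact b.dense_span
  · rintro _ ⟨k, rfl⟩
    refine b.repr.injective (lp.ext (funext fun h => ?_))
    rw [b.repr_apply_apply, b.repr_apply_apply]
    refine (expand X Y h k).unique ?_
    -- Convolution is commutative: the substitution `l ↦ h + k - l` exchanges the two factors.
    have := (Equiv.subLeft (h + k)).hasSum_iff.2 (expand Y X h k)
    refine this.congr_fun ?_
    intro l
    have h1 := coeff X hX h l (k - l)
    have h2 := coeff Y hY l k (h - l)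
    rw [show h + (k - l) = h + k - l by abel, show l + (k - l) = k by abel] at h1
    rw [show k + (h - l) = h + k - l by abel, show l + (h - l) = h by abel] at h2
    simp only [Function.comp_apply, Equiv.subLeft_apply]
    rw [h1, h2, mul_comm]

/-- Surjectivity makes each `τ h` unitary, so that adjoints of equivariant maps are equivariant too;
this brings `Y* Z` into the commutative algebra on `K`. -/
theorem adjoint_comp_comm_translate (hs : ∀ h, Function.Surjective (τ h))
    {Y Z : K →L[ℂ] E} (hY : ∀ h v, Y (τ h v) = T h (Y v)) (hZ : ∀ h v, Z (τ h v) = T h (Z v))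
    (h : H) (v : K) : (adjoint Y ∘L Z) (τ h v) = τ h ((adjoint Y ∘L Z) v) := by
  refine ext_inner_right ℂ fun w => ?_
  obtain ⟨w, rfl⟩ := hs h w
  rw [comp_apply, comp_apply, adjoint_inner_left, hY, hZ, LinearIsometry.inner_map_map,
    LinearIsometry.inner_map_map, adjoint_inner_left]

/-- Equivariant maps have orthogonal ranges if one of them is supported on the range of an
equivariant orthogonal projection and the other one vanishes there. -/
theorem inner_eq_zero_of_equivariant [AddCommGroup H] (b : HilbertBasis H ℂ K)
    (hτ : ∀ h k, τ h (b k) = b (h + k)) (hs : ∀ h, Function.Surjective (τ h))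
    {e : K →L[ℂ] K} (he : IsSelfAdjoint e) (hec : ∀ h v, e (τ h v) = τ h (e v))
    {Y Z : K →L[ℂ] E} (hY : ∀ h v, Y (τ h v) = T h (Y v)) (hZ : ∀ h v, Z (τ h v) = T h (Z v))
    (hYe : ∀ v, Y (e v) = Y v) (hZe : ∀ v, Z (e v) = 0) (u v : K) :
    inner ℂ (Y u) (Z v) = 0 := by
  have hcomm := b.comm_of_comm_translate hτ hec (adjoint_comp_comm_translate hs hY hZ) v
  -- Since `e` commutes with `Y* Z`, one gets `e Y* Z = Y* Z e = 0`.
  rw [comp_apply, comp_apply, hZe, map_zero] at hcomm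
  rw [← hYe, ← adjoint_inner_right, ← he.adjoint_eq, adjoint_inner_left, hcomm, inner_zero_right]

/-- A series of pairwise orthogonal vectors whose partial sums are bounded converges. -/
theorem summable_of_pairwise_orthogonal {d : ℕ → E}
    (hd : ∀ m n, m < n → inner ℂ (d m) (d n) = 0) {C : ℝ}
    (hC : ∀ n, ‖∑ k ∈ Finset.range n, d k‖ ≤ C) : Summable d := by
  have hne : ∀ m n, m ≠ n → inner ℂ (d m) (d n) = 0 := by
    intro m n h
    rcases h.lt_or_gt with h | h
    · exact hd m n h
    · rw [← inner_conj_symm, hd n m h, map_zero]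
  have hV : OrthogonalFamily ℂ (fun i => (ℂ ∙ d i : Submodule ℂ E))
      fun i => (ℂ ∙ d i : Submodule ℂ E).subtypeₗᵢ := by
    intro m n h v w
    obtain ⟨a, ha⟩ := Submodule.mem_span_singleton.1 v.2
    obtain ⟨c, hc⟩ := Submodule.mem_span_singleton.1 w.2
    change inner ℂ (v : E) (w : E) = 0
    rw [← ha, ← hc, inner_smul_left, inner_smul_right, hne m n h, mul_zero, mul_zero]
  let f : ∀ i, (ℂ ∙ d i : Submodule ℂ E) := fun i => ⟨d i, Submodule.mem_span_singleton_self _⟩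
  refine (hV.summable_iff_norm_sq_summable f).2 ?_
  refine summable_of_sum_range_le (c := C ^ 2) (fun _ => sq_nonneg _) fun n => ?_
  have := hV.norm_sum f (Finset.range n)
  rw [← this]
  exact pow_le_pow_left₀ (norm_nonneg _) (hC n) 2

end EquivariantOperators

/-! ### Solving the refinement equation by iteration. -/

section EquivariantIsometry

open ContinuousLinearMap Filter

variable {H E K : Type*}
  [NormedAddCommGroup E] [InnerProductSpace ℂ E] [CompleteSpace E]
  [NormedAddCommGroup K] [InnerProductSpace ℂ K] [CompleteSpace K]
  {T : H → E →ₗᵢ[ℂ] E} {τ : H → K →ₗᵢ[ℂ] K}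

/-- The pointwise limit of a sequence of linear isometries. -/
def LinearIsometry.ofTendsto (L : ℕ → K →L[ℂ] E) (hL : ∀ n v, ‖L n v‖ = ‖v‖) (f : K → E)
    (hf : ∀ v, Tendsto (fun n => L n v) atTop (𝓝 (f v))) : K →ₗᵢ[ℂ] E where
  toLinearMap := linearMapOfTendsto f (fun n => (L n : K →ₗ[ℂ] E)) (tendsto_pi_nhds.2 hf)
  norm_map' v := by
    refine tendsto_nhds_unique ((hf v).norm) ?_
    simp only [hL]
    exact tendsto_const_nhds

/-- An equivariant partial isometry `J` agrees on its initial space with an equivariant isometry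
`L` that satisfies the refinement equation `L = J + D L R (1 - J* J)`. The iteration of this
equation starts from an equivariant isometry `ι` with `ι = D ι R`. -/
theorem exists_equivariant_isometry [AddCommGroup H] (b : HilbertBasis H ℂ K)
    (hτ : ∀ h k, τ h (b k) = b (h + k)) (hs : ∀ h, Function.Surjective (τ h))
    {J : K →L[ℂ] E} (hJ : ∀ h v, J (τ h v) = T h (J v)) (hJJ : ∀ v, J (adjoint J (J v)) = J v)
    {D : E ≃ₗᵢ[ℂ] E} {α : H → H} (hD : ∀ h x, D (T (α h) x) = T h (D x))
    {ι : K →ₗᵢ[ℂ] E} (hι : ∀ h v, ι (τ h v) = T h (ι v))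
    {R : K →ₗᵢ[ℂ] K} (hR : ∀ h v, R (τ h v) = τ (α h) (R v)) (hιR : ∀ v, D (ι (R v)) = ι v) :
    ∃ (L : K →ₗᵢ[ℂ] E) (M : K → K), (∀ h v, L (τ h v) = T h (L v)) ∧
      (∀ v, L v = J v + D (L (M v))) ∧ ∀ v, L (adjoint J (J v)) = J v := by
  set e : K →L[ℂ] K := adjoint J ∘L J with he
  have he_apply : ∀ v, e v = adjoint J (J v) := fun v => rfl
  have hesa : IsSelfAdjoint e := by
    rw [isSelfAdjoint_iff', he, adjoint_comp, adjoint_adjoint]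
  have hec : ∀ h v, e (τ h v) = τ h (e v) := adjoint_comp_comm_translate hs hJ hJ
  have hee : ∀ v, e (e v) = e v := fun v => by rw [he_apply, he_apply, hJJ]
  let DC : E →L[ℂ] E := D.toContinuousLinearEquiv
  let M : K →L[ℂ] K := R.toContinuousLinearMap ∘L (ContinuousLinearMap.id ℂ K - e)
  have hM : ∀ v, M v = R (v - e v) := fun v => rfl
  have hMe : ∀ v, M (e v) = 0 := fun v => by rw [hM, hee, sub_self, map_zero]
  have hMτ : ∀ h v, M (τ h v) = τ (α h) (M v) := fun h v => by
    rw [hM, hM, hec, ← map_sub, hR]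
  have hstep : ∀ Y : K →L[ℂ] E, (∀ h v, Y (τ h v) = T h (Y v)) →
      ∀ h v, (DC ∘L Y ∘L M) (τ h v) = T h ((DC ∘L Y ∘L M) v) := by
    intro Y hY h v
    change D (Y (M (τ h v))) = T h (D (Y (M v)))
    rw [hMτ, hY, hD]
  have hstep0 : ∀ (Y : K →L[ℂ] E) v, (DC ∘L Y ∘L M) (e v) = 0 := fun Y v => by
    change D (Y (M (e v))) = 0
    rw [hMe, map_zero, map_zero]
  obtain ⟨S, hS0, hS⟩ : ∃ S : ℕ → K →L[ℂ] E, S 0 = ι.toContinuousLinearMap ∧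
      ∀ n, S (n + 1) = J + DC ∘L S n ∘L M :=
    ⟨fun n => Nat.rec ι.toContinuousLinearMap (fun _ Y => J + DC ∘L Y ∘L M) n, rfl, fun _ => rfl⟩
  have hSτ : ∀ n h v, S n (τ h v) = T h (S n v) := by
    intro n
    induction n with
    | zero => rw [hS0]; exact hι
    | succ n ih =>
      intro h v
      rw [hS, add_apply, add_apply, hJ, hstep _ ih, map_add]
  have hSn : ∀ n v, ‖S n v‖ = ‖v‖ := by
    intro n
    induction n with
    | zero => rw [hS0]; exact ι.norm_map
    | succ n ih =>
      intro v
      -- `J` lives on `e` and `D S_n M` vanishes there, so the two summands of `S (n + 1) v` are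
      -- orthogonal, with norms `‖e v‖` and `‖v - e v‖`.
      have h1 := inner_eq_zero_of_equivariant b hτ hs hesa hec hJ (hstep _ (hSτ n)) hJJ
        (hstep0 (S n)) v v
      have h2 : ‖(DC ∘L S n ∘L M) v‖ = ‖v - e v‖ := by
        change ‖D (S n (M v))‖ = _
        rw [D.norm_map, ih, hM, R.norm_map]
      have h3 : inner ℂ (e v) (v - e v) = 0 := by
        rw [← adjoint_inner_right, hesa.adjoint_eq, map_sub, hee, sub_self, inner_zero_right]
      have h4 : ‖J v‖ = ‖e v‖ := by
        have : inner ℂ (J v) (J v) = inner ℂ (e v) (e v) := by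
          rw [← adjoint_inner_right e, hesa.adjoint_eq, hee, he_apply, adjoint_inner_right]
        rw [inner_self_eq_norm_sq_to_K, inner_self_eq_norm_sq_to_K] at this
        have h5 : ‖J v‖ ^ 2 = ‖e v‖ ^ 2 := by exact_mod_cast this
        exact (pow_left_inj₀ (norm_nonneg _) (norm_nonneg _) two_ne_zero).1 h5
      have h5 := norm_add_sq_eq_norm_sq_add_norm_sq_of_inner_eq_zero _ _ h1
      have h6 := norm_add_sq_eq_norm_sq_add_norm_sq_of_inner_eq_zero _ _ h3
      rw [add_sub_cancel] at h6
      rw [h2, h4, ← h6] at h5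
      rw [hS, add_apply]
      exact (mul_self_inj (norm_nonneg _) (norm_nonneg _)).1 h5
  obtain ⟨d, hdS⟩ : ∃ d : ℕ → K →L[ℂ] E, ∀ n, d n = S (n + 1) - S n := ⟨_, fun _ => rfl⟩
  have hd : ∀ n, d (n + 1) = DC ∘L d n ∘L M := by
    intro n
    ext v
    rw [hdS, hdS, sub_apply, hS (n + 1), hS n]
    simp only [sub_apply, add_apply, comp_apply, map_sub]
    abel
  have hdτ : ∀ n h v, d n (τ h v) = T h (d n v) := fun n h v => by
    rw [hdS, sub_apply, sub_apply, hSτ, hSτ, map_sub]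
  -- The choice of starting point enters here: `D ι R = ι` turns `d 0` into `J - ι e`, which lives
  -- on `e`.
  have hd0 : ∀ v, d 0 (e v) = d 0 v := by
    have h0 : ∀ v, d 0 v = J v - ι (e v) := by
      intro v
      rw [hdS, hS, hS0]
      change J v + D (ι (R (v - e v))) - ι v = _
      rw [hιR, map_sub]
      abel
    intro v
    rw [h0, h0, hee, he_apply, hJJ]
  -- For `m = 0`, `d 0` lives on `e` while all later differences vanish there; the general case
  -- follows by removing the unitary `D` from both sides.
  have horth : ∀ m n, m < n → ∀ u v, inner ℂ (d m u) (d n v) = 0 := by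
    intro m
    induction m with
    | zero =>
      intro n hn
      obtain ⟨n, rfl⟩ := Nat.exists_eq_add_one.2 hn
      refine inner_eq_zero_of_equivariant b hτ hs hesa hec (hdτ 0) (hdτ _) hd0 ?_
      rw [hd]
      exact hstep0 _
    | succ m ih =>
      intro n hn u v
      obtain ⟨n, rfl⟩ := Nat.exists_eq_add_one.2 (Nat.zero_lt_of_lt hn)
      rw [hd, hd]
      change inner ℂ (D (d m (M u))) (D (d n (M v))) = 0
      rw [D.inner_map_map]
      exact ih n (by omega) _ _
  have hpart : ∀ n v, ∑ k ∈ Finset.range n, d k v = S n v - S 0 v := fun n v => by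
    simp only [hdS, sub_apply]
    exact Finset.sum_range_sub (fun k => S k v) n
  have hsum : ∀ v, Summable fun n => d n v := by
    intro v
    -- The partial sums telescope to `S n v - S 0 v`, a difference of two vectors of norm `‖v‖`.
    refine summable_of_pairwise_orthogonal (fun m n h => horth m n h v v) (C := 2 * ‖v‖) fun n => ?_
    rw [hpart]
    refine (norm_sub_le _ _).trans ?_
    rw [hSn, hSn, two_mul]
  have hlim : ∀ v, Tendsto (fun n => S n v) atTop (𝓝 (S 0 v + ∑' n, d n v)) := by
    intro v
    have h1 := ((hsum v).hasSum.tendsto_sum_nat).const_add (S 0 v)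
    refine h1.congr fun n => ?_
    rw [hpart, add_sub_cancel]
  let L := LinearIsometry.ofTendsto S hSn _ hlim
  have hL : ∀ v, Tendsto (fun n => S n v) atTop (𝓝 (L v)) := hlim
  have hLeq : ∀ v, L v = J v + D (L (M v)) := by
    intro v
    refine tendsto_nhds_unique ((tendsto_add_atTop_iff_nat 1).2 (hL v)) ?_
    simp only [hS]
    exact ((D.continuous.tendsto _).comp (hL (M v))).const_add (J v)
  refine ⟨L, M, fun h v => ?_, hLeq, fun v => ?_⟩
  · refine tendsto_nhds_unique (hL (τ h v)) ?_
    simp only [hSτ]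
    exact ((T h).continuous.tendsto _).comp (hL v)
  · rw [hLeq, hJJ, ← he_apply, hMe, map_zero, map_zero, add_zero]

end EquivariantIsometry

/-! ### The synthesis operator of a Parseval frame. -/

section ParsevalFrame

open ContinuousLinearMap

variable {H E K : Type*}
  [NormedAddCommGroup E] [InnerProductSpace ℂ E] [CompleteSpace E]
  [NormedAddCommGroup K] [InnerProductSpace ℂ K] [CompleteSpace K]

/-- The analysis operator of a Parseval frame. -/
noncomputable def VilenkinGroup.IsParsevalFrameFor.analysis {V : Submodule ℂ E} {φ : H → E}
    (hφ : VilenkinGroup.IsParsevalFrameFor V φ) : V →ₗᵢ[ℂ] lp (fun _ : H => ℂ) 2 where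
  toFun f := ⟨fun h => inner ℂ (φ h) (f : E), by
    refine memℓp_gen ?_
    simpa only [ENNReal.toReal_ofNat, Real.rpow_ofNat, norm_inner_symm] using
      hφ.summable f f.2⟩
  map_add' f g := lp.ext (funext fun h => inner_add_right _ _ _)
  map_smul' c f := lp.ext (funext fun h => inner_smul_right _ _ _)
  norm_map' f := by
    have h2 : 0 < (2 : ℝ≥0∞).toReal := by norm_num
    have h : ‖(f : E)‖ ^ 2 = ∑' i, ‖inner ℂ (f : E) (φ i)‖ ^ 2 := by
      refine le_antisymm ?_ ?_
      · simpa only [one_mul] using hφ.lower f f.2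
      · simpa only [one_mul] using hφ.upper f f.2
    refine (pow_left_inj₀ (norm_nonneg _) (norm_nonneg _) two_ne_zero).1 ?_
    rw [Submodule.coe_norm, h]
    have := lp.norm_rpow_eq_tsum h2 (⟨fun h => inner ℂ (φ h) (f : E), by
      refine memℓp_gen ?_
      simpa only [ENNReal.toReal_ofNat, Real.rpow_ofNat, norm_inner_symm] using
        hφ.summable f f.2⟩ : lp (fun _ : H => ℂ) 2)
    simp only [ENNReal.toReal_ofNat, Real.rpow_ofNat] at this
    refine this.trans (tsum_congr fun i => ?_)
    rw [norm_inner_symm]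

/-- The synthesis operator of a Parseval frame for a closed subspace is a partial isometry onto
this subspace. -/
theorem VilenkinGroup.IsParsevalFrameFor.exists_synthesis (b : HilbertBasis H ℂ K)
    {V : Submodule ℂ E} (hV : IsClosed (V : Set E)) {φ : H → E}
    (hφ : VilenkinGroup.IsParsevalFrameFor V φ) :
    ∃ J : K →L[ℂ] E, (∀ h, J (b h) = φ h) ∧ (∀ v, J v ∈ V) ∧ ∀ f ∈ V, J (adjoint J f) = f := by
  have : CompleteSpace V := hV.completeSpace_coe
  let Θ : V →ₗᵢ[ℂ] K := b.repr.symm.toLinearIsometry.comp hφ.analysis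
  let C : V →L[ℂ] K := Θ.toContinuousLinearMap
  have hC : adjoint C ∘L C = ContinuousLinearMap.id ℂ V :=
    (norm_map_iff_adjoint_comp_self C).1 Θ.norm_map
  -- The analysis operator `C` is an isometry, so `C* C = 1` on `V`; composing `C*` with the
  -- inclusion gives `J`, and `J* f = C f` for `f ∈ V`.
  refine ⟨V.subtypeL ∘L adjoint C, fun h => ?_, fun v => (adjoint C v).2, fun f hf => ?_⟩
  · have : adjoint C (b h) = ⟨φ h, hφ.mem h⟩ := by
      refine ext_inner_right ℂ fun f => ?_
      rw [adjoint_inner_left, ← b.repr_apply_apply]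
      change (b.repr (b.repr.symm (hφ.analysis f)) : lp (fun _ : H => ℂ) 2) h = _
      rw [LinearIsometryEquiv.apply_symm_apply]
      rfl
    rw [comp_apply, this]
    rfl
  · have h1 : adjoint (V.subtypeL ∘L adjoint C) f = C ⟨f, hf⟩ := by
      refine ext_inner_right ℂ fun w => ?_
      rw [adjoint_inner_left, comp_apply, ← adjoint_inner_right]
      rfl
    rw [h1, comp_apply]
    have h2 : adjoint C (C ⟨f, hf⟩) = ⟨f, hf⟩ := DFunLike.congr_fun hC _
    rw [h2]
    rfl

end ParsevalFrame

/-! ### From a Parseval frame to a refinable vector with orthonormal translates. -/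

section OrthonormalRefinable

/-- The preimage of `W` under `f` is a closed subspace, so membership need only be checked on
generators. -/
theorem Submodule.topologicalClosure_span_range_induction {ι E F : Type*}
    [NormedAddCommGroup E] [InnerProductSpace ℂ E] [NormedAddCommGroup F] [InnerProductSpace ℂ F] {v : ι → E} {W : Submodule ℂ F} (hW : IsClosed (W : Set F))
    (f : E →L[ℂ] F) (hf : ∀ i, f (v i) ∈ W) {x : E}
    (hx : x ∈ (Submodule.span ℂ (range v)).topologicalClosure) : f x ∈ W := by
  have h : (Submodule.span ℂ (range v)).topologicalClosure ≤ W.comap (f : E →ₗ[ℂ] F) := by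
    refine Submodule.topologicalClosure_minimal _ ?_ (hW.preimage f.continuous)
    rw [Submodule.span_le]
    rintro _ ⟨i, rfl⟩
    exact hf i
  exact h hx

variable {H E : Type*} [AddCommGroup H]
  [NormedAddCommGroup E] [InnerProductSpace ℂ E] [CompleteSpace E]

/-- A closed subspace that has a Parseval frame of translates and is contained in its dilate
embeds into a subspace with an orthonormal basis of translates that is contained in its dilate,
as soon as one refinable vector with orthonormal translates exists. -/
theorem exists_orthonormal_refinable {T : H → E →ₗᵢ[ℂ] E}
    (hT : ∀ h k x, T h (T k x) = T (h + k) x) (hT0 : ∀ x, T 0 x = x)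
    {D : E ≃ₗᵢ[ℂ] E} {α : H → H} (hD : ∀ h x, D (T (α h) x) = T h (D x))
    {χ : E} (hχ : Orthonormal ℂ fun h => T h χ)
    (hDχ : D.symm χ ∈ Submodule.span ℂ (range fun h => T h χ))
    {V : Submodule ℂ E} (hV : IsClosed (V : Set E)) (hVD : ∀ f ∈ V, D.symm f ∈ V)
    {φ : E} (hφ : VilenkinGroup.IsParsevalFrameFor V fun h => T h φ) :
    ∃ ψ : E, (Orthonormal ℂ fun h => T h ψ) ∧
      V ≤ (Submodule.span ℂ (range fun h => T h ψ)).topologicalClosure ∧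
      ∀ f ∈ (Submodule.span ℂ (range fun h => T h ψ)).topologicalClosure,
        D.symm f ∈ (Submodule.span ℂ (range fun h => T h ψ)).topologicalClosure := by
  set X := (Submodule.span ℂ (range fun h => T h χ)).topologicalClosure with hX
  have hXc : IsClosed (X : Set E) := Submodule.isClosed_topologicalClosure _
  have hTχ : ∀ h, T h χ ∈ X := fun h =>
    Submodule.le_topologicalClosure _ (Submodule.subset_span ⟨h, rfl⟩)
  have hTX : ∀ h, ∀ x ∈ X, T h x ∈ X := fun h x hx =>
    Submodule.topologicalClosure_span_range_induction hXc (T h).toContinuousLinearMap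
      (fun k => by
        change T h (T k χ) ∈ X
        rw [hT]
        exact hTχ _) hx
  have hD' : ∀ h x, D.symm (T h x) = T (α h) (D.symm x) := fun h x => by
    rw [LinearIsometryEquiv.symm_apply_eq, hD, LinearIsometryEquiv.apply_symm_apply]
  have hDX : ∀ x ∈ X, D.symm x ∈ X := fun x hx =>
    Submodule.topologicalClosure_span_range_induction hXc
      (D.symm.toLinearIsometry.toContinuousLinearMap)
      (fun k => by
        change D.symm (T k χ) ∈ X
        rw [hD']
        exact hTX _ _ (Submodule.le_topologicalClosure _ hDχ)) hx
  have : CompleteSpace X := hXc.completeSpace_coe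
  let τ : H → X →ₗᵢ[ℂ] X := fun h =>
    ⟨(T h).toLinearMap.restrict (hTX h), fun x => (T h).norm_map x⟩
  let R : X →ₗᵢ[ℂ] X :=
    ⟨D.symm.toLinearIsometry.toLinearMap.restrict hDX, fun x => D.symm.norm_map x⟩
  let v : H → X := fun h => ⟨T h χ, hTχ h⟩
  have hv : Orthonormal ℂ v := by
    rw [← X.subtypeₗᵢ.orthonormal_comp_iff]
    exact hχ
  -- A vector of `X` orthogonal to all generators is orthogonal to `X`, hence to itself.
  have hv0 : (Submodule.span ℂ (range v))ᗮ = ⊥ := by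
    rw [Submodule.eq_bot_iff]
    intro x hx
    have h : (x : E) ∈ (ℂ ∙ (x : E))ᗮ := by
      refine Submodule.topologicalClosure_span_range_induction
        (Submodule.isClosed_orthogonal _) (ContinuousLinearMap.id ℂ E) (fun k => ?_) x.2
      rw [ContinuousLinearMap.id_apply, Submodule.mem_orthogonal_singleton_iff_inner_left]
      exact (Submodule.mem_orthogonal _ _).1 hx (v k) (Submodule.subset_span ⟨k, rfl⟩)
    rw [Submodule.mem_orthogonal_singleton_iff_inner_left, inner_self_eq_zero] at h
    exact Subtype.ext h
  let b := HilbertBasis.mkOfOrthogonalEqBot hv hv0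
  have hb : ∀ h, b h = v h := fun h => by
    rw [show (b : H → X) = v from HilbertBasis.coe_mkOfOrthogonalEqBot hv hv0]
  have hτ : ∀ h k, τ h (b k) = b (h + k) := fun h k => by
    rw [hb, hb]
    exact Subtype.ext (hT h k χ)
  have hs : ∀ h, Function.Surjective (τ h) := fun h x => by
    refine ⟨τ (-h) x, Subtype.ext ?_⟩
    change T h (T (-h) x) = x
    rw [hT, add_neg_cancel, hT0]
  obtain ⟨J, hJb, hJV, hJJ⟩ := hφ.exists_synthesis b hV
  have hb_dense : Dense (Submodule.span ℂ (range b) : Set X) := by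
    rw [Submodule.dense_iff_topologicalClosure_eq_top]
    exact b.dense_span
  have hJτ : ∀ h w, J (τ h w) = T h (J w) := by
    intro h w
    have : J ∘L (τ h).toContinuousLinearMap = (T h).toContinuousLinearMap ∘L J := by
      refine ContinuousLinearMap.ext_on hb_dense ?_
      rintro _ ⟨k, rfl⟩
      change J (τ h (b k)) = T h (J (b k))
      rw [hτ, hJb, hJb, hT]
    exact DFunLike.congr_fun this w
  -- The iteration starts from the inclusion of `X`, with `R` the restriction of `D⁻¹`; then `D ι R
  -- = ι` is immediate.
  obtain ⟨L, M, hLτ, hL, hLJ⟩ := exists_equivariant_isometry (ι := X.subtypeₗᵢ) (R := R) b hτ hs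
    hJτ (fun w => hJJ _ (hJV w)) hD (fun _ _ => rfl) (fun h w => Subtype.ext (hD' h w))
    (fun w => D.apply_symm_apply (w : E))
  have hLb : ∀ h, T h (L (b 0)) = L (b h) := fun h => by rw [← hLτ, hτ, add_zero]
  set W := (Submodule.span ℂ (range fun h => T h (L (b 0)))).topologicalClosure with hW
  have hWc : IsClosed (W : Set E) := Submodule.isClosed_topologicalClosure _
  have hLW : ∀ w, L w ∈ W := fun w =>
    Submodule.topologicalClosure_span_range_induction hWc L.toContinuousLinearMap
      (fun k => by
        change L (b k) ∈ W
        rw [← hLb]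
        exact Submodule.le_topologicalClosure _ (Submodule.subset_span ⟨k, rfl⟩))
      (by rw [b.dense_span]; trivial)
  have hWL : ∀ f ∈ W, ∃ w, L w = f := fun f hf =>
    Submodule.topologicalClosure_span_range_induction
      (W := LinearMap.range L.toLinearMap) L.isometry.isClosedEmbedding.isClosed_range
      (ContinuousLinearMap.id ℂ E) (fun k => ⟨b k, (hLb k).symm⟩) hf
  have hVW : V ≤ W := fun f hf => by
    -- `f = J (J* f) = L (J* J (J* f))`.
    rw [← hJJ f hf, ← hLJ]
    exact hLW _
  refine ⟨L (b 0), ?_, hVW, fun f hf => ?_⟩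
  · simp only [hLb]
    exact b.orthonormal.comp_linearIsometry L
  · obtain ⟨w, rfl⟩ := hWL f hf
    change D.symm (L w) ∈ W
    -- `D⁻¹ L w = D⁻¹ J w + L (M w)`, where `D⁻¹ J w ∈ V ⊆ W`.
    rw [hL w, map_add, D.symm_apply_apply]
    exact W.add_mem (hVW (hVD _ (hJV w))) (hLW _)

end OrthonormalRefinable

/-! ### Dilation and translation as isometries of `L²`. -/

namespace VilenkinGroup

theorem A_mem_H {p : ℕ} {h : VilenkinGroup p} (hh : h ∈ H p) : A p h ∈ H p := fun j hj =>
  hh (j + 1) (by omega)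

variable {p : ℕ} [NeZero p]

theorem map_continuousAddEquiv_haar (φ : VilenkinGroup p ≃ₜ+ VilenkinGroup p) :
    (haar p).map φ = (addEquivAddHaarChar φ)⁻¹ • haar p := by
  conv_rhs => rw [← addEquivAddHaarChar_smul_map (haar p) φ]
  rw [smul_smul, inv_mul_cancel₀ (addEquivAddHaarChar_pos φ).ne', one_smul]

theorem quasiMeasurePreserving_continuousAddEquiv (φ : VilenkinGroup p ≃ₜ+ VilenkinGroup p) :
    Measure.QuasiMeasurePreserving φ (haar p) (haar p) := by
  refine ⟨φ.continuous.measurable, ?_⟩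
  rw [map_continuousAddEquiv_haar]
  exact Measure.smul_absolutelyContinuous

theorem eLpNorm_comp_continuousAddEquiv (φ : VilenkinGroup p ≃ₜ+ VilenkinGroup p) (f : L2 p) :
    eLpNorm (fun x => f (φ x)) 2 (haar p) =
      ((addEquivAddHaarChar φ)⁻¹ : ℝ≥0) ^ (1 / (2 : ℝ)) * eLpNorm f 2 (haar p) := by
  have h := eLpNorm_map_measure (p := 2) (f := φ) (g := f) (μ := haar p)
    (by
      rw [map_continuousAddEquiv_haar]
      exact (Lp.aestronglyMeasurable f).mono_ac Measure.smul_absolutelyContinuous)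
    φ.continuous.measurable.aemeasurable
  rw [map_continuousAddEquiv_haar] at h
  rw [show (fun x => f (φ x)) = f ∘ φ from rfl, ← h]
  have := eLpNorm_smul_measure_of_ne_zero (p := 2) (μ := haar p)
    (c := ((addEquivAddHaarChar φ)⁻¹ : ℝ≥0))
    (by exact_mod_cast inv_ne_zero (addEquivAddHaarChar_pos φ).ne') f
  simpa using this

theorem memLp_comp_continuousAddEquiv (φ : VilenkinGroup p ≃ₜ+ VilenkinGroup p) (f : L2 p) :
    MemLp (fun x => f (φ x)) 2 (haar p) := by
  refine ⟨(Lp.aestronglyMeasurable f).comp_quasiMeasurePreserving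
    (quasiMeasurePreserving_continuousAddEquiv φ), ?_⟩
  rw [eLpNorm_comp_continuousAddEquiv]
  exact ENNReal.mul_lt_top (by finiteness) (Lp.eLpNorm_lt_top f)

theorem compA_add (f g : L2 p) : compA (f + g) = compA f + compA g := by
  refine Lp.ext ?_
  filter_upwards [coeFn_compA (f + g), coeFn_compA f, coeFn_compA g, Lp.coeFn_add (compA f) (compA g),
    (quasiMeasurePreserving_continuousAddEquiv (A p)).ae (Lp.coeFn_add f g)] with x h1 h2 h3 h4 h5
  rw [h1, h4, Pi.add_apply, h2, h3, h5, Pi.add_apply]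

theorem compA_smul (c : ℂ) (f : L2 p) : compA (c • f) = c • compA f := by
  refine Lp.ext ?_
  filter_upwards [coeFn_compA (c • f), coeFn_compA f, Lp.coeFn_smul c (compA f),
    (quasiMeasurePreserving_continuousAddEquiv (A p)).ae (Lp.coeFn_smul c f)] with x h1 h2 h4 h5
  rw [h1, h4, Pi.smul_apply, h2, h5, Pi.smul_apply]

theorem surjective_compA : Function.Surjective (compA : L2 p → L2 p) := by
  intro g
  refine ⟨(memLp_comp_continuousAddEquiv (A p).symm g).toLp, Lp.ext ?_⟩
  filter_upwards [coeFn_compA (memLp_comp_continuousAddEquiv (A p).symm g).toLp,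
    (quasiMeasurePreserving_continuousAddEquiv (A p)).ae
      (memLp_comp_continuousAddEquiv (A p).symm g).coeFn_toLp] with x h1 h2
  rw [h1, h2, ContinuousAddEquiv.symm_apply_apply]

/-- The factor by which `f ↦ f(A ·)` changes the norm of `L²`. -/
noncomputable def dilationFactor (p : ℕ) [NeZero p] : ℝ :=
  ((addEquivAddHaarChar (A p))⁻¹ : ℝ≥0) ^ (1 / (2 : ℝ))

theorem dilationFactor_pos : 0 < dilationFactor p :=
  Real.rpow_pos_of_pos (NNReal.coe_pos.2 (inv_pos.2 (addEquivAddHaarChar_pos (A p)))) _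

theorem dilationFactor_ne_zero : (dilationFactor p : ℂ) ≠ 0 :=
  Complex.ofReal_ne_zero.2 dilationFactor_pos.ne'

/-- An automorphism scales Haar measure by a constant, so the norm changes by a fixed factor. Its
value is never computed; positivity suffices for normalizing. -/
theorem norm_compA (f : L2 p) : ‖compA f‖ = dilationFactor p * ‖f‖ := by
  rw [compA, Lp.norm_toLp, eLpNorm_comp_continuousAddEquiv, ENNReal.toReal_mul, Lp.norm_def,
    dilationFactor, ← ENNReal.toReal_rpow, ENNReal.coe_toReal]

/-- The unitary dilation, the normalization of `f ↦ f(A ·)`. -/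
noncomputable def dilation (p : ℕ) [NeZero p] : L2 p ≃ₗᵢ[ℂ] L2 p :=
  LinearIsometryEquiv.ofSurjective
    { toFun := fun f => (dilationFactor p : ℂ)⁻¹ • compA f
      map_add' := fun f g => by rw [compA_add, smul_add]
      map_smul' := fun c f => by rw [compA_smul, smul_comm, RingHom.id_apply]
      norm_map' := fun f => by
        change ‖(dilationFactor p : ℂ)⁻¹ • compA f‖ = ‖f‖
        rw [norm_smul, norm_compA, norm_inv, Complex.norm_real, Real.norm_eq_abs,
          abs_of_pos dilationFactor_pos, inv_mul_cancel_left₀ dilationFactor_pos.ne'] }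
    (fun g => by
      obtain ⟨f, hf⟩ := surjective_compA ((dilationFactor p : ℂ) • g)
      refine ⟨f, ?_⟩
      change (dilationFactor p : ℂ)⁻¹ • compA f = g
      rw [hf, inv_smul_smul₀ dilationFactor_ne_zero])

theorem dilation_apply (f : L2 p) : dilation p f = (dilationFactor p : ℂ)⁻¹ • compA f := rfl

theorem compA_eq_smul_dilation (f : L2 p) : compA f = (dilationFactor p : ℂ) • dilation p f := by
  rw [dilation_apply, smul_inv_smul₀ dilationFactor_ne_zero]

theorem compA_mem_iff {W : Submodule ℂ (L2 p)} {f : L2 p} : compA f ∈ W ↔ dilation p f ∈ W := by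
  rw [dilation_apply, W.smul_mem_iff (inv_ne_zero dilationFactor_ne_zero)]

theorem translate_translate (h k : VilenkinGroup p) (f : L2 p) :
    translate h (translate k f) = translate (h + k) f := by
  refine Lp.ext ?_
  filter_upwards [coeFn_translate h (translate k f), coeFn_translate (h + k) f,
    (measurePreserving_sub_right (haar p) h).quasiMeasurePreserving.ae
      (coeFn_translate k f)] with x h1 h2 h3
  rw [h1, h2, h3, sub_sub]

theorem translate_zero (f : L2 p) : translate 0 f = f := by
  refine Lp.ext ?_
  filter_upwards [coeFn_translate 0 f] with x h1
  rw [h1, sub_zero]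

theorem compA_translate (h : VilenkinGroup p) (f : L2 p) :
    compA (translate (A p h) f) = translate h (compA f) := by
  refine Lp.ext ?_
  filter_upwards [coeFn_compA (translate (A p h) f), coeFn_translate h (compA f),
    (measurePreserving_sub_right (haar p) h).quasiMeasurePreserving.ae (coeFn_compA f),
    (quasiMeasurePreserving_continuousAddEquiv (A p)).ae (coeFn_translate (A p h) f)]
    with x h1 h2 h3 h4
  rw [h1, h2, h3, h4, map_sub]

/-- Translation by `h` as a linear isometry. -/
noncomputable def translation (h : VilenkinGroup p) : L2 p →ₗᵢ[ℂ] L2 p :=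
  Lp.compMeasurePreservingₗᵢ ℂ (fun x => x - h) (measurePreserving_sub_right (haar p) h)

theorem translation_apply (h : VilenkinGroup p) (f : L2 p) : translation h f = translate h f := rfl

theorem dilation_translation (h : VilenkinGroup p) (f : L2 p) :
    dilation p (translation (A p h) f) = translation h (dilation p f) := by
  rw [dilation_apply, dilation_apply, map_smul, translation_apply, translation_apply,
    compA_translate]

end VilenkinGroup

/-! ### The subgroups `U_l`, `H`, `N_m` and the Haar scaling function. -/

namespace VilenkinGroup

section Topology

variable {p : ℕ}

theorem A_mem_U_iff {l : ℤ} {x : VilenkinGroup p} : A p x ∈ U p l ↔ x ∈ U p (l + 1) := by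
  refine ⟨fun h j hj => ?_, fun h j hj => h (j + 1) (by omega)⟩
  have := h (j - 1) (by omega)
  rwa [digit_A, sub_add_cancel] at this

theorem eq_zero_of_mem_H_of_mem_U {x : VilenkinGroup p} (h : x ∈ H p) (h0 : x ∈ U p 0) : x = 0 :=
  digit_ext fun j => by
    rcases lt_or_ge 0 j with hj | hj
    · exact h j hj
    · exact h0 j hj

/-- The element whose only possibly nonzero digit is the `k`-th one. -/
def single (k : ℤ) (i : ZMod p) : VilenkinGroup p :=
  ⟨fun j => if j = k then i else 0, k, fun _ hj => if_neg hj.ne⟩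

theorem digit_single (k : ℤ) (i : ZMod p) (j : ℤ) :
    (single k i).digit j = if j = k then i else 0 := rfl

theorem single_zero_mem_H (i : ZMod p) : single 0 i ∈ H p := fun _ hj => if_neg hj.ne'

theorem A_sub_single_mem_U_iff {x : VilenkinGroup p} {i : ZMod p} :
    A p x - single 0 i ∈ U p 0 ↔ x ∈ U p 0 ∧ i = x.digit 1 := by
  have key : ∀ j, (A p x - single 0 i).digit j = x.digit (j + 1) - if j = 0 then i else 0 := by
    intro j
    rw [sub_eq_add_neg, digit_add, digit_neg, digit_A, digit_single, sub_eq_add_neg]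
  constructor
  · intro h
    refine ⟨fun j hj => ?_, ?_⟩
    · have := h (j - 1) (by omega)
      rwa [key, if_neg (by omega), sub_zero, sub_add_cancel] at this
    · have := h 0 le_rfl
      rw [key, if_pos rfl, zero_add, sub_eq_zero] at this
      exact this.symm
  · rintro ⟨h, rfl⟩ j hj
    rw [key]
    split_ifs with h0
    · rw [h0, zero_add, sub_self]
    · rw [h (j + 1) (by omega), sub_zero]

instance instT2Space : T2Space (VilenkinGroup p) := by
  refine IsTopologicalAddGroup.t2Space_of_zero_sep fun x hx => ?_
  obtain ⟨j, hj⟩ : ∃ j, x.digit j ≠ 0 := by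
    by_contra! h
    exact hx (digit_ext h)
  exact ⟨U p j, (isOpen_U j).mem_nhds (U p j).zero_mem, fun h => hj (h j le_rfl)⟩

theorem neBot_nhdsNE_zero [Nontrivial (ZMod p)] : (𝓝[≠] (0 : VilenkinGroup p)).NeBot := by
  refine (nhdsWithin_hasBasis nhds_zero_hasBasis _).neBot_iff.2 fun {l} _ => ?_
  refine ⟨single (l + 1) 1, fun j hj => if_neg (by omega), fun h => ?_⟩
  have h1 := congrArg (fun x : VilenkinGroup p => x.digit (l + 1)) h
  simp only [digit_single, if_true, digit_zero] at h1
  exact one_ne_zero h1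

/-- Elements of `H` have only finitely many nonzero digits, so they embed into the finitely
supported functions on `ℤ`. -/
theorem countable_H [NeZero p] : (H p : Set (VilenkinGroup p)).Countable := by
  have hfin : ∀ x : H p, (Function.support (x : VilenkinGroup p).digit).Finite := by
    intro x
    obtain ⟨k, hk⟩ := (x : VilenkinGroup p).2
    refine (Set.finite_Icc k 0).subset fun j hj => ?_
    by_contra h
    rw [Set.mem_Icc, not_and_or, not_le, not_le] at h
    exact hj (h.elim (hk j) (x.2 j))
  have : Countable (ZMod p) := Finite.to_countable
  refine Set.countable_coe_iff.1 (Function.Injective.countable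
    (f := fun x : H p => Finsupp.ofSupportFinite _ (hfin x)) fun x y hxy => ?_)
  exact Subtype.ext (digit_ext fun j => DFunLike.congr_fun hxy j)

/-- The subgroup of the `x` with `x_j = 0` for `0 < j ≤ m`, which is `H + U_m` for `m ≥ 0`. -/
def N (p : ℕ) (m : ℤ) : AddSubgroup (VilenkinGroup p) where
  carrier := {x | ∀ j : ℤ, 0 < j → j ≤ m → x.digit j = 0}
  zero_mem' := fun _ _ _ => rfl
  add_mem' := fun {x y} hx hy j h0 hj => by rw [digit_add, hx j h0 hj, hy j h0 hj, add_zero]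
  neg_mem' := fun {x} hx j h0 hj => by rw [digit_neg, hx j h0 hj, neg_zero]

theorem isOpen_N (m : ℤ) : IsOpen (N p m : Set (VilenkinGroup p)) :=
  AddSubgroup.isOpen_mono (H₁ := U p m) (fun _ hx j _ hj => hx j hj) (isOpen_U m)

theorem antitone_N : Antitone (N p) := fun _ _ h _ hx j h0 hj => hx j h0 (hj.trans h)

theorem iInter_N : ⋂ n : ℕ, (N p n : Set (VilenkinGroup p)) = H p := by
  ext x
  rw [mem_iInter]
  constructor
  · intro h j hj
    exact h j.toNat j hj (by omega)
  · intro h n j hj _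
    exact h j hj

theorem mem_N_of_add_mem_U {m : ℤ} {h x : VilenkinGroup p} (hh : h ∈ H p) (hx : x + h ∈ U p m) :
    x ∈ N p m := by
  intro j h0 hj
  have := hx j hj
  rwa [digit_add, hh j h0, add_zero] at this

end Topology

section HaarScaling

variable {p : ℕ} [NeZero p]

/-- Points are null because the group is not discrete, and `H` is countable. -/
theorem haar_H [Nontrivial (ZMod p)] : haar p (H p) = 0 := by
  have : (𝓝[≠] (0 : VilenkinGroup p)).NeBot := neBot_nhdsNE_zero
  exact countable_H.measure_zero _

/-- The indicator function of `U_0`. -/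
noncomputable def haarScaling (p : ℕ) [NeZero p] : L2 p :=
  indicatorConstLp 2 (isOpen_U 0).measurableSet (by rw [haar_U_zero]; exact ENNReal.one_ne_top)
    (1 : ℂ)

theorem coeFn_haarScaling :
    haarScaling p =ᵐ[haar p] (U p 0 : Set (VilenkinGroup p)).indicator fun _ => (1 : ℂ) :=
  indicatorConstLp_coeFn

theorem coeFn_translate_haarScaling (h : VilenkinGroup p) :
    translate h (haarScaling p) =ᵐ[haar p]
      fun x => (U p 0 : Set (VilenkinGroup p)).indicator (fun _ => (1 : ℂ)) (x - h) := by
  filter_upwards [coeFn_translate h (haarScaling p),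
    (measurePreserving_sub_right (haar p) h).quasiMeasurePreserving.ae coeFn_haarScaling]
    with x h1 h2
  rw [h1, h2]

theorem orthonormal_translate_haarScaling :
    Orthonormal ℂ fun h : H p => translation (h : VilenkinGroup p) (haarScaling p) := by
  refine ⟨fun h => ?_, fun h k hhk => ?_⟩
  · rw [LinearIsometry.norm_map, haarScaling, norm_indicatorConstLp two_ne_zero ENNReal.ofNat_ne_top,
      measureReal_def, haar_U_zero]
    simp
  · simp only
    rw [L2.inner_def]
    refine integral_eq_zero_of_ae ?_
    filter_upwards [coeFn_translate_haarScaling (h : VilenkinGroup p),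
      coeFn_translate_haarScaling (k : VilenkinGroup p)] with x h1 h2
    rw [translation_apply, translation_apply, h1, h2]
    -- If the supports met at `x`, then `h - k` would lie in both `H` and `U_0`, which meet only in
    -- `0`.
    by_cases hx : x - h ∈ U p 0
    · rw [indicator_of_notMem (a := x - k), inner_zero_right, Pi.zero_apply]
      intro hk
      refine hhk (Subtype.ext (sub_eq_zero.1 (eq_zero_of_mem_H_of_mem_U
        ((H p).sub_mem h.2 k.2) ?_)))
      have := (U p 0).sub_mem hk hx
      rwa [sub_sub_sub_cancel_left] at this
    · rw [indicator_of_notMem (a := x - h) hx, inner_zero_left, Pi.zero_apply]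

theorem coeFn_sum {ι : Type*} (s : Finset ι) (f : ι → L2 p) :
    (∑ i ∈ s, f i : L2 p) =ᵐ[haar p] fun x => ∑ i ∈ s, f i x := by
  classical
  induction s using Finset.induction_on with
  | empty =>
    filter_upwards [Lp.coeFn_zero ℂ 2 (haar p)] with x hx
    rw [Finset.sum_empty, Finset.sum_empty, hx, Pi.zero_apply]
  | insert a s ha ih =>
    filter_upwards [ih, Lp.coeFn_add (f a) (∑ i ∈ s, f i)] with x h1 h2
    rw [Finset.sum_insert ha, Finset.sum_insert ha, h2, Pi.add_apply, h1]

/-- `A` maps `U_0` onto the disjoint union of the cosets `single 0 i + U_0`; the coset of `A x` is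
read off from the digit `x_1`. This is the refinement equation of the indicator function. -/
theorem compA_sum_translate_haarScaling :
    compA (∑ i : ZMod p, translate (single 0 i) (haarScaling p)) = haarScaling p := by
  refine Lp.ext ?_
  have h : ∀ᵐ x ∂haar p, ∀ i : ZMod p, translate (single 0 i) (haarScaling p) (A p x) =
      (U p 0 : Set (VilenkinGroup p)).indicator (fun _ => (1 : ℂ)) (A p x - single 0 i) := by
    have : Countable (ZMod p) := Finite.to_countable
    rw [ae_all_iff]
    intro i
    have h := coeFn_translate_haarScaling (single 0 i : VilenkinGroup p)
    filter_upwards [(quasiMeasurePreserving_continuousAddEquiv (A p)).ae h] with x hx using hx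
  filter_upwards [coeFn_compA (∑ i : ZMod p, translate (single 0 i) (haarScaling p)), h,
    (quasiMeasurePreserving_continuousAddEquiv (A p)).ae
      (coeFn_sum Finset.univ fun i : ZMod p => translate (single 0 i) (haarScaling p)),
    coeFn_haarScaling (p := p)] with x h1 h2 h3 h4
  rw [h1, h3, h4]
  rw [Finset.sum_congr rfl fun i _ => h2 i]
  by_cases hx : x ∈ U p 0
  · rw [Finset.sum_eq_single (x.digit 1) (fun i _ hi => indicator_of_notMem (fun h => hi
      (A_sub_single_mem_U_iff.1 h).2) _) (fun h => absurd (Finset.mem_univ _) h),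
      indicator_of_mem (show x ∈ (U p 0 : Set _) from hx),
      indicator_of_mem (A_sub_single_mem_U_iff.2 ⟨hx, rfl⟩)]
  · rw [indicator_of_notMem (show x ∉ (U p 0 : Set _) from hx)]
    exact Finset.sum_eq_zero fun i _ => indicator_of_notMem (fun h => hx
      (A_sub_single_mem_U_iff.1 h).1) _

theorem dilation_symm_haarScaling_mem : (dilation p).symm (haarScaling p) ∈
    Submodule.span ℂ (range fun h : H p => translation (h : VilenkinGroup p) (haarScaling p)) := by
  have h : (dilation p).symm (haarScaling p) =
      (dilationFactor p : ℂ) • ∑ i : ZMod p, translate (single 0 i) (haarScaling p) := by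
    rw [LinearIsometryEquiv.symm_apply_eq, map_smul, ← compA_eq_smul_dilation,
      compA_sum_translate_haarScaling]
  rw [h]
  exact Submodule.smul_mem _ _ (Submodule.sum_mem _ fun i _ =>
    Submodule.subset_span ⟨⟨single 0 i, single_zero_mem_H i⟩, rfl⟩)

end HaarScaling

end VilenkinGroup

/-! ### Triviality of the intersection of the dilates. -/

/-- A bound for the inner products of a vector with an orthonormal family gives a bound for its
inner products with the closed span of the family. -/
theorem Orthonormal.norm_inner_le_of_mem_topologicalClosure_span {ι E : Type*}
    [NormedAddCommGroup E] [InnerProductSpace ℂ E] {v : ι → E} (hv : Orthonormal ℂ v) {g : E}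
    {B : ℝ} (hB0 : 0 ≤ B) (hB : ∀ s : Finset ι, ∑ i ∈ s, ‖(inner ℂ (v i) g : ℂ)‖ ^ 2 ≤ B ^ 2)
    {w : E} (hw : w ∈ (Submodule.span ℂ (range v)).topologicalClosure) :
    ‖(inner ℂ w g : ℂ)‖ ≤ B * ‖w‖ := by
  have hclosed : IsClosed {w : E | ‖(inner ℂ w g : ℂ)‖ ≤ B * ‖w‖} :=
    isClosed_le (by fun_prop) (by fun_prop)
  refine closure_minimal ?_ hclosed hw
  intro w hw
  obtain ⟨l, rfl⟩ := Finsupp.mem_span_range_iff_exists_finsupp.1 hw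
  have hnorm : ‖l.sum fun i a => a • v i‖ ^ 2 = ∑ i ∈ l.support, ‖l i‖ ^ 2 := by
    have h := hv.inner_sum l l l.support
    rw [Finsupp.sum, ← Complex.ofReal_inj, ← Complex.coe_algebraMap]
    have h2 := inner_self_eq_norm_sq_to_K (𝕜 := ℂ) (∑ i ∈ l.support, l i • v i)
    rw [h] at h2
    rw [map_pow]
    refine h2.symm.trans ?_
    rw [map_sum]
    refine Finset.sum_congr rfl fun i _ => ?_
    rw [RCLike.conj_mul, map_pow]
  have h1 : ‖(inner ℂ (l.sum fun i a => a • v i) g : ℂ)‖ ≤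
      ∑ i ∈ l.support, ‖l i‖ * ‖(inner ℂ (v i) g : ℂ)‖ := by
    rw [Finsupp.sum, sum_inner]
    refine (norm_sum_le _ _).trans (Finset.sum_le_sum fun i _ => ?_)
    rw [inner_smul_left, norm_mul, RCLike.norm_conj]
  refine h1.trans ?_
  refine abs_le_of_sq_le_sq' ?_ (mul_nonneg hB0 (norm_nonneg _)) |>.2
  -- Cauchy–Schwarz on the coefficients, whose square sum is `‖w‖²` by orthonormality.
  refine (Finset.sum_mul_sq_le_sq_mul_sq _ _ _).trans ?_
  rw [mul_pow, hnorm, mul_comm]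
  exact mul_le_mul_of_nonneg_right (hB _) (Finset.sum_nonneg fun _ _ => sq_nonneg _)

namespace VilenkinGroup

variable {p : ℕ} [NeZero p]

/-- The product of `f` with the indicator function of `s`. -/
noncomputable def restrictTo {s : Set (VilenkinGroup p)} (hs : MeasurableSet s) (f : L2 p) : L2 p :=
  ((Lp.memLp f).indicator hs).toLp

theorem coeFn_restrictTo {s : Set (VilenkinGroup p)} (hs : MeasurableSet s) (f : L2 p) :
    restrictTo hs f =ᵐ[haar p] s.indicator f :=
  ((Lp.memLp f).indicator hs).coeFn_toLp

theorem inner_restrictTo {s : Set (VilenkinGroup p)} (hs : MeasurableSet s) {f g : L2 p}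
    (hg : ∀ᵐ x ∂haar p, x ∉ s → g x = 0) : inner ℂ (restrictTo hs f) g = inner ℂ f g := by
  rw [L2.inner_def, L2.inner_def]
  refine integral_congr_ae ?_
  filter_upwards [hg, coeFn_restrictTo hs f] with x h1 h2
  rw [h2]
  by_cases hx : x ∈ s
  · rw [indicator_of_mem hx]
  · rw [h1 hx, inner_zero_right, inner_zero_right]

theorem enorm_restrictTo_sq {s : Set (VilenkinGroup p)} (hs : MeasurableSet s) (f : L2 p) :
    ‖restrictTo hs f‖ₑ ^ 2 = ∫⁻ x in s, ‖f x‖ₑ ^ 2 ∂haar p := by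
  rw [Lp.enorm_def, restrictTo, eLpNorm_congr_ae (MemLp.coeFn_toLp _),
    eLpNorm_indicator_eq_eLpNorm_restrict hs,
    eLpNorm_eq_lintegral_rpow_enorm_toReal two_ne_zero ENNReal.ofNat_ne_top, ← ENNReal.rpow_natCast,
    ← ENNReal.rpow_mul]
  norm_num

theorem enorm_inner_sq_le {s : Set (VilenkinGroup p)} (hs : MeasurableSet s) {f g : L2 p}
    (hg : ∀ᵐ x ∂haar p, x ∉ s → g x = 0) :
    ‖(inner ℂ f g : ℂ)‖ₑ ^ 2 ≤ ‖g‖ₑ ^ 2 * ∫⁻ x in s, ‖f x‖ₑ ^ 2 ∂haar p := by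
  rw [← inner_restrictTo hs hg, ← enorm_restrictTo_sq hs, ← mul_pow, mul_comm]
  gcongr
  have := norm_inner_le_norm (𝕜 := ℂ) (restrictTo hs f) g
  rw [enorm_eq_nnnorm, enorm_eq_nnnorm, enorm_eq_nnnorm]
  exact_mod_cast this

/-- The measure with density `|f|²`. -/
noncomputable def energy (f : L2 p) : Measure (VilenkinGroup p) :=
  (haar p).withDensity fun x => ‖f x‖ₑ ^ 2

theorem energy_univ_ne_top (f : L2 p) : energy f univ ≠ ∞ := by
  rw [energy, withDensity_apply _ MeasurableSet.univ, ← enorm_restrictTo_sq MeasurableSet.univ]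
  exact ENNReal.pow_ne_top enorm_ne_top

instance instIsFiniteMeasure_energy (f : L2 p) : IsFiniteMeasure (energy f) :=
  ⟨(energy_univ_ne_top f).lt_top⟩

theorem setLIntegral_enorm_translate_sq {s : Set (VilenkinGroup p)} (hs : MeasurableSet s)
    (h : VilenkinGroup p) (f : L2 p) :
    ∫⁻ x in s, ‖translate h f x‖ₑ ^ 2 ∂haar p = energy f {y | y + h ∈ s} := by
  have hs' : MeasurableSet {y | y + h ∈ s} := (continuous_add_const h).measurable hs
  rw [energy, withDensity_apply _ hs', ← lintegral_indicator hs, ← lintegral_indicator hs',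
    
    ← lintegral_sub_right_eq_self (μ := haar p)
      ({y | y + h ∈ s}.indicator fun y => ‖f y‖ₑ ^ 2) h]
  refine lintegral_congr_ae ?_
  filter_upwards [coeFn_translate h f] with x hx
  by_cases hxs : x ∈ s
  · have hxs' : x - h ∈ {y | y + h ∈ s} := by
      change x - h + h ∈ s
      rwa [sub_add_cancel]
    rw [indicator_of_mem hxs, indicator_of_mem hxs', hx]
  · have hxs' : x - h ∉ {y | y + h ∈ s} := by
      change x - h + h ∉ s
      rwa [sub_add_cancel]
    rw [indicator_of_notMem hxs, indicator_of_notMem hxs']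

/-- Against `g` supported in `U_m`, the translate by `h` contributes at most `‖g‖²` times the energy
of `ψ` on `U_m - h`. For `m ≥ 0` these sets are disjoint, because `H` meets `U_m` only in `0`, and
they lie in `N_m`. -/
theorem sum_enorm_inner_translate_sq_le {m : ℤ} (hm : 0 ≤ m) (ψ : L2 p) {g : L2 p}
    (hg : ∀ᵐ x ∂haar p, x ∉ U p m → g x = 0) (s : Finset (H p)) :
    ∑ h ∈ s, ‖(inner ℂ (translate (h : VilenkinGroup p) ψ) g : ℂ)‖ₑ ^ 2 ≤
      ‖g‖ₑ ^ 2 * energy ψ (N p m) := by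
  have hU : MeasurableSet (U p m : Set (VilenkinGroup p)) := (isOpen_U m).measurableSet
  have h1 : ∑ h ∈ s, energy ψ {y | y + (h : VilenkinGroup p) ∈ (U p m : Set (VilenkinGroup p))} ≤
      energy ψ (N p m) := by
    rw [← measure_biUnion_finset]
    · refine measure_mono (iUnion₂_subset fun h _ x hx => mem_N_of_add_mem_U h.2 hx)
    · intro h _ k _ hhk
      refine Set.disjoint_left.2 fun x hx hx' => hhk (Subtype.ext (sub_eq_zero.1 ?_))
      refine eq_zero_of_mem_H_of_mem_U ((H p).sub_mem h.2 k.2) ?_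
      have h2 := (U p m).sub_mem hx hx'
      rw [add_sub_add_left_eq_sub] at h2
      exact fun j hj => h2 j (hj.trans hm)
    · exact fun h _ => (continuous_add_const (h : VilenkinGroup p)).measurable hU
  refine (Finset.sum_le_sum fun h _ => enorm_inner_sq_le hU hg).trans ?_
  rw [← Finset.mul_sum]
  simp only [setLIntegral_enorm_translate_sq hU]
  gcongr

/-- The sets `N_n` decrease to `H`, which is null for Haar measure and hence for the finite measure
with density `|ψ|²`. -/
theorem tendsto_energy_N [Nontrivial (ZMod p)] (ψ : L2 p) :
    Filter.Tendsto (fun n : ℕ => (energy ψ).real (N p n)) Filter.atTop (𝓝 0) := by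
  have h0 : energy ψ (H p) = 0 := withDensity_absolutelyContinuous _ _ haar_H
  have h := tendsto_measure_iInter_atTop (μ := energy ψ)
    (s := fun n : ℕ => (N p n : Set (VilenkinGroup p)))
    (fun n => (isOpen_N (n : ℤ)).measurableSet.nullMeasurableSet)
    (fun m n hmn => antitone_N (Int.ofNat_le.2 hmn)) ⟨0, measure_ne_top _ _⟩
  rw [iInter_N, h0] at h
  exact (ENNReal.tendsto_toReal ENNReal.zero_ne_top).comp h

theorem norm_inner_le_of_mem_span_translates {m : ℤ} (hm : 0 ≤ m) {ψ : L2 p}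
    (hψ : Orthonormal ℂ fun h : H p => translation (h : VilenkinGroup p) ψ) {g : L2 p}
    (hg : ∀ᵐ x ∂haar p, x ∉ U p m → g x = 0) {w : L2 p}
    (hw : w ∈ (Submodule.span ℂ
      (range fun h : H p => translation (h : VilenkinGroup p) ψ)).topologicalClosure) :
    ‖(inner ℂ w g : ℂ)‖ ≤ ‖g‖ * √((energy ψ).real (N p m)) * ‖w‖ := by
  refine hψ.norm_inner_le_of_mem_topologicalClosure_span (by positivity) (fun s => ?_) hw
  have h := ENNReal.toReal_mono (by finiteness) (sum_enorm_inner_translate_sq_le hm ψ hg s)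
  rw [ENNReal.toReal_sum (fun _ _ => by finiteness), ENNReal.toReal_mul, ENNReal.toReal_pow,
    toReal_enorm] at h
  simp only [ENNReal.toReal_pow, toReal_enorm] at h
  rwa [mul_pow, Real.sq_sqrt measureReal_nonneg]

theorem compA_eq_zero_off {l : ℤ} {g : L2 p} (hg : ∀ᵐ x ∂haar p, x ∉ U p l → g x = 0) :
    ∀ᵐ x ∂haar p, x ∉ U p (l + 1) → dilation p g x = 0 := by
  rw [dilation_apply]
  filter_upwards [coeFn_compA g, (quasiMeasurePreserving_continuousAddEquiv (A p)).ae hg,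
    Lp.coeFn_smul (dilationFactor p : ℂ)⁻¹ (compA g)] with x h1 h2 h3 hx
  rw [h3, Pi.smul_apply, h1, h2 (mt A_mem_U_iff.1 hx), smul_zero]

/-- A function all of whose dilates lie in the closed span of the orthonormal translates of a
single function vanishes. -/
theorem eq_zero_of_forall_dilation_mem [Nontrivial (ZMod p)] {ψ : L2 p}
    (hψ : Orthonormal ℂ fun h : H p => translation (h : VilenkinGroup p) ψ) {f : L2 p}
    (hf : ∀ n : ℕ, (dilation p ^ n) f ∈ (Submodule.span ℂ
      (range fun h : H p => translation (h : VilenkinGroup p) ψ)).topologicalClosure) :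
    f = 0 := by
  have hinner : ∀ (l : ℕ) (g : L2 p), (∀ᵐ x ∂haar p, x ∉ U p (-l) → g x = 0) →
      inner ℂ f g = 0 := by
    intro l g hg
    have hsupp : ∀ n : ℕ, ∀ᵐ x ∂haar p, x ∉ U p (-l + n) → (dilation p ^ n) g x = 0 := by
      intro n
      induction n with
      | zero => simpa using hg
      | succ n ih =>
        rw [pow_succ', Nat.cast_succ, ← add_assoc]
        exact compA_eq_zero_off ih
    -- Apply the unitary `D^(l + n)` to both vectors: `g` moves from `U_(-l)` into `U_n`, while `f`
    -- stays in the closed span by hypothesis.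
    have hbound : ∀ n : ℕ, ‖(inner ℂ f g : ℂ)‖ ≤ ‖g‖ * √((energy ψ).real (N p n)) * ‖f‖ := by
      intro n
      have h1 := hsupp (l + n)
      rw [Nat.cast_add, neg_add_cancel_left] at h1
      have h2 := norm_inner_le_of_mem_span_translates (Int.natCast_nonneg n) hψ h1 (hf (l + n))
      rwa [LinearIsometryEquiv.inner_map_map, LinearIsometryEquiv.norm_map,
        LinearIsometryEquiv.norm_map] at h2
    have hlim : Filter.Tendsto (fun n : ℕ => ‖g‖ * √((energy ψ).real (N p n)) * ‖f‖)
        Filter.atTop (𝓝 0) := by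
      have := (((Real.continuous_sqrt.tendsto 0).comp (tendsto_energy_N ψ)).const_mul
        ‖g‖).mul_const ‖f‖
      simpa using this
    exact norm_le_zero_iff.1 (ge_of_tendsto' hlim hbound)
  have hU : ∀ l : ℕ, MeasurableSet (U p (-l) : Set (VilenkinGroup p)) := fun l =>
    (isOpen_U _).measurableSet
  -- Testing `f` against its own restriction to `U_(-l)` shows that this restriction vanishes.
  have hres : ∀ l : ℕ, restrictTo (hU l) f = 0 := by
    intro l
    have h0 : ∀ᵐ x ∂haar p, x ∉ U p (-l) → restrictTo (hU l) f x = 0 := by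
      filter_upwards [coeFn_restrictTo (hU l) f] with x hx hxU
      rw [hx, indicator_of_notMem hxU]
    rw [← inner_self_eq_zero (𝕜 := ℂ), inner_restrictTo (hU l) h0, hinner l _ h0]
  refine Lp.ext ?_
  have h1 : ∀ᵐ x ∂haar p, ∀ l : ℕ,
      (U p (-l) : Set (VilenkinGroup p)).indicator f x = 0 := by
    refine ae_all_iff.2 fun l => ?_
    have h2 := coeFn_restrictTo (hU l) f
    rw [hres l] at h2
    filter_upwards [h2, Lp.coeFn_zero ℂ 2 (haar p)] with x h3 h4
    rw [← h3, h4, Pi.zero_apply]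
  filter_upwards [h1, Lp.coeFn_zero ℂ 2 (haar p)] with x hx h0
  obtain ⟨k, hk⟩ := x.2
  -- The digits vanish for `j < k`, so `l ≥ 1 - k` is needed; `toNat` covers `k > 1`. Thus the
  -- `U_(-l)` exhaust the group.
  have hxU : x ∈ U p (-((1 - k).toNat : ℤ)) := fun j hj => hk j (by omega)
  have := hx (1 - k).toNat
  rw [indicator_of_mem hxU] at this
  rw [this, h0, Pi.zero_apply]

end VilenkinGroup

/-! ### Ladders of dilates and the main theorem. -/

namespace VilenkinGroup

variable {p : ℕ} [NeZero p]

/-- The dilates `D^j W` of a subspace `W`. -/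
noncomputable def dilates (W : Submodule ℂ (L2 p)) (j : ℤ) : Submodule ℂ (L2 p) :=
  W.comap ((dilation p ^ (-j)).toLinearEquiv : L2 p →ₗ[ℂ] L2 p)

theorem mem_dilates {W : Submodule ℂ (L2 p)} {j : ℤ} {f : L2 p} :
    f ∈ dilates W j ↔ (dilation p ^ (-j)) f ∈ W := Iff.rfl

theorem IsDilationLadder.dilation_zpow_mem_iff {V : ℤ → Submodule ℂ (L2 p)}
    (hV : IsDilationLadder V) (j : ℤ) (f : L2 p) : (dilation p ^ j) f ∈ V j ↔ f ∈ V 0 := by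
  have hstep : ∀ j, (dilation p ^ (j + 1)) f ∈ V (j + 1) ↔ (dilation p ^ j) f ∈ V j := by
    intro j
    rw [hV.mem_iff j, compA_mem_iff]
    have h : (dilation p ^ (j + 1)) f = dilation p ((dilation p ^ j) f) := by
      rw [add_comm, zpow_add, zpow_one]
      rfl
    rw [h]
  induction j using Int.induction_on with
  | zero => rfl
  | succ n ih => exact (hstep _).trans ih
  | pred n ih =>
    rw [← hstep, sub_add_cancel]
    exact ih

/-- A ladder is determined by `V 0`, so comparing `V 0` with `W` compares all levels at once. -/
theorem IsDilationLadder.eq_dilates {V : ℤ → Submodule ℂ (L2 p)} (hV : IsDilationLadder V)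
    (j : ℤ) : V j = dilates (V 0) j := by
  ext f
  have h : (dilation p ^ j) ((dilation p ^ (-j)) f) = f := by
    rw [zpow_neg]
    exact (dilation p ^ j).apply_symm_apply f
  rw [mem_dilates, ← hV.dilation_zpow_mem_iff j, h]

end VilenkinGroup

theorem mainTheorem1 (p : ℕ) [Fact p.Prime]
    (V : ℤ → Submodule ℂ (VilenkinGroup.L2 p)) (hV : VilenkinGroup.IsParsevalFMRA V) :
    ∃ W : ℤ → Submodule ℂ (VilenkinGroup.L2 p),
      VilenkinGroup.IsMRA W ∧ ∀ j : ℤ, V j ≤ W j := by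
  open VilenkinGroup in
  obtain ⟨φ, -, hφ⟩ := hV.exists_scaling
  have hVD : ∀ f ∈ V 0, (dilation p).symm f ∈ V 0 := by
    intro f hf
    rw [hV.mem_iff, compA_mem_iff, LinearIsometryEquiv.apply_symm_apply]
    exact hV.le_succ 0 hf
  obtain ⟨ψ, hψ, hVW, hWD⟩ := exists_orthonormal_refinable
    (T := fun h : H p => translation (h : VilenkinGroup p)) (D := dilation p)
    (α := fun h => ⟨A p h, A_mem_H h.2⟩)
    (fun h k f => translate_translate (h : VilenkinGroup p) k f) (fun f => translate_zero f)
    (fun h f => dilation_translation (h : VilenkinGroup p) f) orthonormal_translate_haarScaling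
    dilation_symm_haarScaling_mem (hV.isClosed 0) hVD hφ
  set W := (Submodule.span ℂ
    (range fun h : H p => translation (h : VilenkinGroup p) ψ)).topologicalClosure with hW
  have hle : ∀ j, V j ≤ dilates W j := fun j => by
    rw [hV.eq_dilates j]
    exact Submodule.comap_mono hVW
  have hW0 : dilates W 0 = W := by
    ext f
    rw [mem_dilates, neg_zero, zpow_zero]
    rfl
  refine ⟨dilates W, ⟨⟨fun j => ?_, fun j f hf => ?_, fun j f => ?_, ?_, ?_⟩, ψ, ?_, hψ, ?_⟩, hle⟩
  · exact (Submodule.isClosed_topologicalClosure _).preimage (dilation p ^ (-j)).continuous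
  · rw [mem_dilates, neg_add, add_comm, zpow_add, zpow_neg_one]
    exact hWD _ hf
  · rw [compA_mem_iff, mem_dilates, mem_dilates, neg_add, zpow_add, zpow_neg_one]
    change _ ↔ (dilation p ^ (-j)) ((dilation p).symm (dilation p f)) ∈ W
    rw [LinearIsometryEquiv.symm_apply_apply]
  · refine eq_univ_of_univ_subset ?_
    rw [← hV.closure_iUnion]
    exact closure_mono (iUnion_mono fun j => hle j)
  · refine eq_singleton_iff_unique_mem.2 ⟨mem_iInter.2 fun j => (dilates W j).zero_mem, ?_⟩
    intro f hf
    refine eq_zero_of_forall_dilation_mem hψ fun n => ?_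
    have := mem_iInter.1 hf (-n)
    -- Membership of `f` in the level `-n` says that `D^n f ∈ W`; only the nonpositive levels are
    -- needed.
    rwa [SetLike.mem_coe, mem_dilates, neg_neg, zpow_natCast] at this
  · rw [hW0]
    refine Submodule.le_topologicalClosure _ (Submodule.subset_span ⟨0, ?_⟩)
    exact translate_zero ψ
  · rw [hW0]
    rfl
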